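/- Let $G=(V,E)$ be a finite simple graph whose vertices run the following synchronous algorithm in the beeping model $B_{cd}L$ (in a slot, a beeping vertex learns whether at least one neighbour beeps at the same time, and a listening vertex learns whether at least one neighbour beeps). Each vertex $v$ is either active or coloured, and holds a beeping probability $p_v$ and a colour counter; initially every vertex is active, $p_v=1/2$ and the counter is $0$. In each phase every active vertex increments its counter and beeps with probability $p_v$, all choices being independent. If an active vertex $v$ beeps and no neighbour beeps, $v$ becomes coloured (its colour is the value of the counter) and takes no further part. Every other active vertex stays active; it replaces $p_v$ by $p_v/2$ if some neighbour beeped, and otherwise replaces $p_v$ by $2p_v$ if $p_v<1/2$ and leaves $p_v$ unchanged if $p_v=1/2$. Thus $p_v\in\{2^{-1},2^{-2},2^{-3},\dots\}$ at all times. Consider any configuration, i.e. any assignment to the vertices of a status (active or coloured), a beeping probability in $\{2^{-1},2^{-2},\dots\}$ and a counter value; in particular, any configuration that occurs during an execution. Let the residual graph be the graph formed by the active vertices and the edges of $G$ between them. For a vertex $v$, let $d(v)$ be its degree in the residual graph, let $q_v=\sum_u p_u$, the sum being over the neighbours $u$ of $v$ in the residual graph (for a coloured vertex $v$ put $d(v)=q_v=0$),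 and let $$t_0 = 3\log_2\bigl(5\max\{q_v,1/5\}\bigr)-2\log_2 p_v,\qquad \alpha = 2^{1/36}.$$ Theorem. For every such configuration, every integer $t\ge 0$ and every vertex $v$, the probability that $v$ is active after the next $t$ phases, started from this configuration, is at most $\alpha^{112\,d(v)+t_0-t}$. -/

import Mathlib

/-- A vertex is either still competing for a colour, or it has taken one and left the competition. -/
inductive Status where
  | active
  | coloured

/-- The variables stored at a vertex: its status, its beeping probability `p` and its colour
counter. As `p` starts at `1/2` and is only halved, or doubled when it is below `1/2`, it is always
`2⁻¹, 2⁻², 2⁻³, …`; this invariant is carried along and is re-established by `LocalState.next`. -/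
structure LocalState where
  status : Status
  p : ℝ
  colour : ℕ
  p_eq_pow : ∃ k : ℕ, p = (1 / 2 : ℝ) ^ (k + 1)

namespace LocalState

theorem p_pos (x : LocalState) : 0 < x.p := by
  obtain ⟨k, hk⟩ := x.p_eq_pow
  rw [hk]; positivity

theorem p_le_half (x : LocalState) : x.p ≤ 1 / 2 := by
  obtain ⟨k, hk⟩ := x.p_eq_pow
  rw [hk, pow_succ]
  have : (1 / 2 : ℝ) ^ k ≤ 1 := pow_le_one₀ (by norm_num) (by norm_num)
  linarith

/-- The variables of every vertex when the algorithm starts. -/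
noncomputable def init : LocalState where
  status := .active
  p := 1 / 2
  colour := 0
  p_eq_pow := ⟨0, by norm_num⟩

/-- The values that an active vertex can give to `p`: halved, or doubled unless already `1/2`. -/
noncomputable def halvedP (x : LocalState) : ℝ := x.p / 2

open Classical in
noncomputable def doubledP (x : LocalState) : ℝ := if x.p < 1 / 2 then 2 * x.p else x.p

theorem halvedP_eq_pow (x : LocalState) : ∃ k : ℕ, x.halvedP = (1 / 2 : ℝ) ^ (k + 1) := by
  obtain ⟨k, hk⟩ := x.p_eq_pow
  exact ⟨k + 1, by rw [halvedP, hk, pow_succ _ (k + 1)]; ring⟩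

theorem doubledP_eq_pow (x : LocalState) : ∃ k : ℕ, x.doubledP = (1 / 2 : ℝ) ^ (k + 1) := by
  obtain ⟨k, hk⟩ := x.p_eq_pow
  unfold doubledP
  split_ifs with h
  · cases k with
    | zero => rw [hk] at h; norm_num at h
    | succ k => exact ⟨k, by rw [hk, pow_succ _ (k + 1)]; ring⟩
  · exact ⟨k, hk⟩

/-- The body of the loop run by one vertex. `candidate` says whether the vertex drew to beep, and
`neighbourBeeped` whether at least one neighbour beeped in this slot: a beeping vertex learns this
as an internal collision (sender-side collision detection), a listening one by hearing a beep.
A coloured vertex has left the loop and does not change. -/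
noncomputable def next (x : LocalState) (candidate neighbourBeeped : Bool) : LocalState :=
  match x.status with
  | .coloured => x
  | .active =>
    match candidate, neighbourBeeped with
    -- beeped without internal collision: takes the current colour
    | true, false => ⟨.coloured, x.p, x.colour + 1, x.p_eq_pow⟩
    -- listened and heard nothing
    | false, false => ⟨.active, x.doubledP, x.colour + 1, x.doubledP_eq_pow⟩
    -- some neighbour beeped
    | _, true => ⟨.active, x.halvedP, x.colour + 1, x.halvedP_eq_pow⟩

end LocalState

/-- A global configuration: the variables of all vertices. -/
abbrev Config (V : Type*) := V → LocalState

namespace Config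

variable {V : Type*}

/-- The configuration in which the algorithm starts. -/
noncomputable def init : Config V := fun _ => LocalState.init

/-- The residual graph: the graph of the edges between active vertices. -/
def residual (G : SimpleGraph V) (c : Config V) : SimpleGraph V where
  Adj u v := G.Adj u v ∧ (c u).status = .active ∧ (c v).status = .active
  symm := ⟨fun _ _ h => ⟨h.1.symm, h.2.2, h.2.1⟩⟩
  loopless := ⟨fun _ h => G.loopless.irrefl _ h.1⟩

/-- A vertex beeps in a phase if it is active and its coin makes it a candidate. -/
def Beeps (c : Config V) (coin : V → Bool) (v : V) : Prop :=
  (c v).status = .active ∧ coin v = true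

open Classical in
/-- The configuration after one phase, given the outcomes of the coins. -/
noncomputable def next (G : SimpleGraph V) (c : Config V) (coin : V → Bool) : Config V :=
  fun v => (c v).next (coin v) (decide (∃ u, G.Adj v u ∧ c.Beeps coin u))

variable [Fintype V]

/-- The probability of one outcome of independent coins, the coin of `v` being `true` with
probability `p_v`. -/
noncomputable def coinWeight (c : Config V) (coin : V → Bool) : ENNReal :=
  ∏ v, ENNReal.ofReal (if coin v then (c v).p else 1 - (c v).p)

open Classical in
theorem sum_coinWeight (c : Config V) : ∑ coin : V → Bool, c.coinWeight coin = 1 := by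
  unfold coinWeight
  rw [← Fintype.prod_sum (fun v (b : Bool) =>
    ENNReal.ofReal (if b then (c v).p else 1 - (c v).p))]
  refine Finset.prod_eq_one fun v _ => ?_
  have h0 := (c v).p_pos
  have h1 := (c v).p_le_half
  simp only [Fintype.sum_bool, if_true, Bool.false_eq_true, if_false]
  rw [← ENNReal.ofReal_add h0.le (by linarith)]
  simp

open Classical in
/-- The joint law of the independent coins of one phase. -/
noncomputable def coinLaw (c : Config V) : PMF (V → Bool) :=
  PMF.ofFintype c.coinWeight c.sum_coinWeight

/-- The law of the configuration after one phase. -/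
noncomputable def step (G : SimpleGraph V) (c : Config V) : PMF (Config V) :=
  c.coinLaw.map (c.next G)

/-- The law of the configuration after `t` phases that start in the configuration `c`, with fresh
independent coins in each phase. -/
noncomputable def run (G : SimpleGraph V) : ℕ → Config V → PMF (Config V)
  | 0, c => PMF.pure c
  | t + 1, c => (c.step G).bind (run G t)

/-- The probability that `v` is active after `t` phases that start in the configuration `c`. -/
noncomputable def probActive (G : SimpleGraph V) (c : Config V) (t : ℕ) (v : V) : ENNReal :=
  (run G t c).toOuterMeasure {c' | (c' v).status = .active}

open Classical in
/-- The degree `d(v)` of `v` in the residual graph. -/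
noncomputable def d (G : SimpleGraph V) (c : Config V) (v : V) : ℕ :=
  (c.residual G).degree v

open Classical in
/-- `q_v`, the sum of the beeping probabilities of the neighbours of `v` in the residual graph. -/
noncomputable def q (G : SimpleGraph V) (c : Config V) (v : V) : ℝ :=
  ∑ u ∈ (c.residual G).neighborFinset v, (c u).p

/-- `t₀ = 3 log₂ (5 max(q_v, 1/5)) - 2 log₂ p_v`. -/
noncomputable def tZero (G : SimpleGraph V) (c : Config V) (v : V) : ℝ :=
  3 * Real.logb 2 (5 * max (c.q G v) (1 / 5)) - 2 * Real.logb 2 (c v).p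

end Config

/-- `α = 2^(1/36)`. -/
noncomputable def colouringAlpha : ℝ := (2 : ℝ) ^ (1 / 36 : ℝ)

/-!
The proof exhibits a potential that shrinks by the factor `α` in expectation in every phase. Write
`Φ = α ^ (112 d(v) + t₀) = α ^ (112 d(v)) * max (5 q_v) 1 ^ (1/12) * p_v ^ (-1/18)` while `v` is
active, and `Φ = 0` once `v` is coloured. Then `Φ ≥ 1` as long as `v` is active, so the theorem
follows from `E[Φ'] ≤ α⁻¹ Φ` for one phase (`Config.sum_weight_activePotential_le`) by induction
on the number of phases.

For one phase, `Φ'` is bounded by `Φ` with `5 q_v` replaced by `5 q_v / 2`, times two factors: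

* `ownFactor`, the effect of `p_v`: it is `α²` if `v` hears a beep; otherwise it is `α⁻²` if
  `p_v < 1/2`, and the indicator of `v` not beeping if `p_v = 1/2`.
* `nbrFactor`, the effect of the neighbours: those that hear a beep halve their probabilities, so
  `q_v` exceeds `q_v / 2` only through the mass `Y` of the quiet neighbours, which neither beep nor
  hear a beep. By Bernoulli's inequality the factor is at most `1 + 5/8 Y`. If a neighbour takes a
  colour, the factor `α ^ (-112)` brings it down to `1/4` at most.

The central estimate is that the expectation of `Y` on the event that no neighbour takes a colour
is at most the probability that some neighbour does (`Config.sum_weight_quietMass_le`). It holds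
because turning the coin of a quiet neighbour makes exactly this neighbour take a colour, so that
the turned coin can be recovered from the result; no independence between the neighbours is needed.
Since a loss of a neighbour forces `v` to hear, where `ownFactor` is largest, the growth of the
quiet neighbours is paid for: the two factors together have at most the expectation of `ownFactor`
(`Config.sum_weight_factors_le`).

What remains is an inequality in `q_v`. For `q_v ≥ 2/5` the halving of `q_v` gives the factor
`α⁻³` and `ownFactor ≤ α²`. For `q_v ≤ 2/5`, `v` hears a beep with probability at most `q_v`, and
`phase_bound` concludes; the tight point is `q_v = 1/5`, where it reads `4 + α⁴ ≤ 5 α`.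
-/

/-! ### The constant `α` -/

theorem colouringAlpha_pos : 0 < colouringAlpha := by
  unfold colouringAlpha; positivity

theorem one_lt_colouringAlpha : 1 < colouringAlpha :=
  Real.one_lt_rpow (by norm_num) (by norm_num)

theorem colouringAlpha_rpow (x : ℝ) : colouringAlpha ^ x = (2 : ℝ) ^ (x / 36) := by
  rw [colouringAlpha, ← Real.rpow_mul (by norm_num)]
  congr 1
  ring

theorem colouringAlpha_rpow_mul_logb {y : ℝ} (hy : 0 < y) (k : ℝ) :
    colouringAlpha ^ (k * Real.logb 2 y) = y ^ (k / 36) := by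
  rw [colouringAlpha_rpow, show k * Real.logb 2 y / 36 = Real.logb 2 y * (k / 36) by ring,
    Real.rpow_mul (by norm_num), Real.rpow_logb (by norm_num) (by norm_num) hy]

theorem two_rpow_eighteenth : (2 : ℝ) ^ (1 / 18 : ℝ) = colouringAlpha ^ 2 := by
  rw [← Real.rpow_natCast, colouringAlpha_rpow]
  norm_num

theorem colouringAlpha_pow_36 : colouringAlpha ^ 36 = 2 := by
  rw [← Real.rpow_natCast, colouringAlpha_rpow]
  norm_num

theorem colouringAlpha_lt : colouringAlpha < 1.0195 := by
  refine lt_of_pow_lt_pow_left₀ 36 (by norm_num) ?_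
  rw [colouringAlpha_pow_36]
  norm_num

theorem lt_colouringAlpha : 1.019 < colouringAlpha := by
  refine lt_of_pow_lt_pow_left₀ 36 colouringAlpha_pos.le ?_
  rw [colouringAlpha_pow_36]
  norm_num

theorem two_rpow_twelfth : (2 : ℝ) ^ (1 / 12 : ℝ) = colouringAlpha ^ 3 := by
  rw [← Real.rpow_natCast, colouringAlpha_rpow]
  norm_num

theorem rpow_twelfth_le {m y : ℝ} (hm : 1 ≤ m) (hy : 0 ≤ y) :
    (m * (1 + 15 / 2 * y)) ^ (1 / 12 : ℝ) ≤ m ^ (1 / 12 : ℝ) * (1 + 5 / 8 * y) := by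
  rw [Real.mul_rpow (by linarith) (by positivity)]
  refine mul_le_mul_of_nonneg_left ?_ (by positivity)
  refine (rpow_one_add_le_one_add_mul_self (by linarith) (by norm_num) (by norm_num)).trans ?_
  linarith

/-- The chord of the concave function `y ↦ y ^ (1 / 12)` between `1` and `2`. -/
theorem chord_le_rpow_twelfth {y : ℝ} (h1 : 1 ≤ y) (h2 : y ≤ 2) :
    1 + (y - 1) * (colouringAlpha ^ 3 - 1) ≤ y ^ (1 / 12 : ℝ) := by
  have h := (Real.concaveOn_rpow (p := 1 / 12) (by norm_num) (by norm_num)).2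
    (show (1 : ℝ) ∈ Set.Ici 0 by simp) (show (2 : ℝ) ∈ Set.Ici 0 by simp)
    (show 0 ≤ 2 - y by linarith) (show 0 ≤ y - 1 by linarith) (by ring)
  simp only [smul_eq_mul, Real.one_rpow, two_rpow_twelfth] at h
  rw [show (2 - y) * 1 + (y - 1) * 2 = y by ring] at h
  linarith

/-- The factor of one phase for `q ≤ 2 / 5`, where `q` bounds the probability that the vertex hears
a beep. For `q ≤ 1 / 5` both sides are affine in `q`; beyond, the right side is concave, and the two
ends of the interval suffice. -/
theorem phase_bound {q : ℝ} (h0 : 0 ≤ q) (hq : q ≤ 2 / 5) :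
    (colouringAlpha ^ 2)⁻¹ + (colouringAlpha ^ 2 - (colouringAlpha ^ 2)⁻¹) * q ≤
      colouringAlpha⁻¹ * max (5 * q) 1 ^ (1 / 12 : ℝ) := by
  have hα := colouringAlpha_pos
  have hl := lt_colouringAlpha
  have hu := colouringAlpha_lt
  -- The value at `q = 1 / 5`, where the bound is nearly sharp.
  have h4 : 4 + colouringAlpha ^ 4 ≤ 5 * colouringAlpha := by
    have h : colouringAlpha ^ 4 ≤ 1.0195 ^ 4 := pow_le_pow_left₀ hα.le hu.le 4
    norm_num at h hl
    linarith
  have h40 : 1 ≤ colouringAlpha ^ 4 := one_le_pow₀ one_lt_colouringAlpha.le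
  -- Both sides multiplied by `α²`.
  suffices h : 1 + (colouringAlpha ^ 4 - 1) * q ≤
      colouringAlpha * max (5 * q) 1 ^ (1 / 12 : ℝ) by
    have h' := mul_le_mul_of_nonneg_left h (show 0 ≤ (colouringAlpha ^ 2)⁻¹ by positivity)
    calc _ = (colouringAlpha ^ 2)⁻¹ * (1 + (colouringAlpha ^ 4 - 1) * q) := by
          field_simp
      _ ≤ _ := h'
      _ = _ := by field_simp
  rcases le_total (5 * q) 1 with h5 | h5
  · rw [max_eq_right h5, Real.one_rpow]
    nlinarith
  · rw [max_eq_left h5]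
    have hc := mul_le_mul_of_nonneg_left
      (chord_le_rpow_twelfth h5 (by linarith)) hα.le
    refine le_trans ?_ hc
    nlinarith

/-! ### One vertex in one phase -/

theorem LocalState.doubledP_le (x : LocalState) : x.doubledP ≤ 2 * x.p := by
  have := x.p_pos
  unfold LocalState.doubledP
  split_ifs <;> linarith

namespace Config

variable {V : Type*}

/-- A vertex hears if at least one of its neighbours in `G` beeps. -/
def Hears (G : SimpleGraph V) (c : Config V) (coin : V → Bool) (u : V) : Prop :=
  ∃ w, G.Adj u w ∧ c.Beeps coin w

open Classical in
theorem next_apply (G : SimpleGraph V) (c : Config V) (coin : V → Bool) (u : V) :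
    c.next G coin u = (c u).next (coin u) (decide (c.Hears G coin u)) := rfl

theorem next_of_coloured (G : SimpleGraph V) (c : Config V) (coin : V → Bool) {u : V}
    (hu : (c u).status ≠ .active) : c.next G coin u = c u := by
  classical
  rw [next_apply, LocalState.next.eq_def]
  cases h : (c u).status
  · exact absurd h hu
  · rfl

theorem next_of_hears (G : SimpleGraph V) (c : Config V) (coin : V → Bool) {u : V}
    (hu : (c u).status = .active) (hh : c.Hears G coin u) :
    (c.next G coin u).status = .active ∧ (c.next G coin u).p = (c u).p / 2 := by
  classical
  rw [next_apply, LocalState.next.eq_def, hu, decide_eq_true hh]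
  cases coin u <;> exact ⟨rfl, rfl⟩

theorem next_of_alone (G : SimpleGraph V) (c : Config V) (coin : V → Bool) {u : V}
    (hu : (c u).status = .active) (hh : ¬ c.Hears G coin u) (hb : coin u = true) :
    (c.next G coin u).status = .coloured := by
  classical
  rw [next_apply, LocalState.next.eq_def, hu, decide_eq_false hh, hb]

theorem next_of_silence (G : SimpleGraph V) (c : Config V) (coin : V → Bool) {u : V}
    (hu : (c u).status = .active) (hh : ¬ c.Hears G coin u) (hb : coin u = false) :
    (c.next G coin u).status = .active ∧ (c.next G coin u).p = (c u).doubledP := by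
  classical
  rw [next_apply, LocalState.next.eq_def, hu, decide_eq_false hh, hb]
  exact ⟨rfl, rfl⟩

theorem active_of_next_active (G : SimpleGraph V) (c : Config V) (coin : V → Bool) {u : V}
    (hu : (c.next G coin u).status = .active) : (c u).status = .active := by
  by_contra h
  rw [next_of_coloured G c coin h] at hu
  exact h hu

theorem ite_coin_nonneg (c : Config V) (b : Bool) (u : V) :
    0 ≤ if b then (c u).p else 1 - (c u).p := by
  have h0 := (c u).p_pos
  have h1 := (c u).p_le_half
  split_ifs <;> linarith

theorem hears_mono (G : SimpleGraph V) (c : Config V) {coin coin' : V → Bool} {w : V}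
    (h : ∀ x, coin x = true → coin' x = true) (hw : c.Hears G coin w) : c.Hears G coin' w := by
  obtain ⟨x, hx, ha, hb⟩ := hw
  exact ⟨x, hx, ha, h x hb⟩

theorem hears_update_self [DecidableEq V] (G : SimpleGraph V) (c : Config V) (coin : V → Bool)
    (u : V) (b : Bool) :
    c.Hears G (Function.update coin u b) u ↔ c.Hears G coin u := by
  constructor <;> rintro ⟨x, hx, ha, hb⟩ <;> refine ⟨x, hx, ha, ?_⟩
  · rwa [Function.update_of_ne hx.ne'] at hb
  · rwa [Function.update_of_ne hx.ne']

open Classical in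
/-- A bound for the factor that `v` itself contributes to the change of the potential: the factor
coming from `p_v`, or `0` if `v` takes a colour. That a vertex may take a colour is needed only if
`p_v = 1 / 2`, where silence does not raise `p_v`; for `p_v < 1 / 2` this `0` is bounded by `α⁻²`. -/
noncomputable def ownFactor (G : SimpleGraph V) (c : Config V) (coin : V → Bool) (v : V) : ℝ :=
  if c.Hears G coin v then colouringAlpha ^ 2
  else if (c v).p < 1 / 2 then (colouringAlpha ^ 2)⁻¹
  else if coin v = false then 1 else 0

theorem ownFactor_nonneg (G : SimpleGraph V) (c : Config V) (coin : V → Bool) (v : V) :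
    0 ≤ c.ownFactor G coin v := by
  have := colouringAlpha_pos
  unfold ownFactor
  split_ifs <;> positivity

theorem ownFactor_le (G : SimpleGraph V) (c : Config V) (coin : V → Bool) (v : V) :
    c.ownFactor G coin v ≤ colouringAlpha ^ 2 := by
  have h1 : 1 ≤ colouringAlpha ^ 2 := one_le_pow₀ one_lt_colouringAlpha.le
  have h2 : (colouringAlpha ^ 2)⁻¹ ≤ 1 := inv_le_one_of_one_le₀ h1
  unfold ownFactor
  split_ifs <;> linarith

theorem rpow_p_next_le (G : SimpleGraph V) (c : Config V) (coin : V → Bool) {v : V}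
    (hv : (c.next G coin v).status = .active) :
    (c.next G coin v).p ^ (-(1 / 18) : ℝ) ≤
      (c v).p ^ (-(1 / 18) : ℝ) * c.ownFactor G coin v := by
  have h0 := (c v).p_pos
  have hact := active_of_next_active G c coin hv
  unfold ownFactor
  by_cases hh : c.Hears G coin v
  · rw [if_pos hh, (next_of_hears G c coin hact hh).2, Real.div_rpow h0.le (by norm_num),
      Real.rpow_neg (by norm_num : (0 : ℝ) ≤ 2), two_rpow_eighteenth, div_inv_eq_mul]
  · rw [if_neg hh]
    cases hb : coin v
    · rw [(next_of_silence G c coin hact hh hb).2, LocalState.doubledP]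
      split_ifs with hp
      · rw [mul_comm, Real.mul_rpow h0.le (by norm_num),
          Real.rpow_neg (by norm_num : (0 : ℝ) ≤ 2), two_rpow_eighteenth]
      · simp
      · simp_all
    · rw [next_of_alone G c coin hact hh hb] at hv
      cases hv

/-! ### Neighbourhoods in the residual graph -/

variable [Fintype V]

open Classical in
/-- The neighbours of `v` in the residual graph. -/
noncomputable def nbrs (G : SimpleGraph V) (c : Config V) (v : V) : Finset V :=
  Finset.univ.filter fun u => (c.residual G).Adj v u

theorem mem_nbrs {G : SimpleGraph V} {c : Config V} {u v : V} :
    u ∈ c.nbrs G v ↔ G.Adj v u ∧ (c v).status = .active ∧ (c u).status = .active := by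
  classical
  rw [nbrs, Finset.mem_filter]
  exact and_iff_right (Finset.mem_univ u)

theorem d_eq_card (G : SimpleGraph V) (c : Config V) (v : V) :
    c.d G v = (c.nbrs G v).card := by
  classical
  rw [d, ← SimpleGraph.card_neighborFinset_eq_degree]
  congr 1
  ext u
  simp [nbrs]

theorem q_eq_sum (G : SimpleGraph V) (c : Config V) (v : V) :
    c.q G v = ∑ u ∈ c.nbrs G v, (c u).p := by
  classical
  rw [q]
  refine Finset.sum_congr ?_ fun _ _ => rfl
  ext u
  simp [nbrs]

theorem q_nonneg (G : SimpleGraph V) (c : Config V) (v : V) : 0 ≤ c.q G v := by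
  rw [q_eq_sum]
  exact Finset.sum_nonneg fun u _ => (c u).p_pos.le

theorem nbrs_next_subset (G : SimpleGraph V) (c : Config V) (coin : V → Bool) (v : V) :
    (c.next G coin).nbrs G v ⊆ c.nbrs G v := by
  intro u hu
  rw [mem_nbrs] at hu ⊢
  exact ⟨hu.1, active_of_next_active G c coin hu.2.1, active_of_next_active G c coin hu.2.2⟩

/-- Some neighbour of `v` in the residual graph beeps alone in its neighbourhood, and so takes a
colour in this phase. -/
def LosesNbr (G : SimpleGraph V) (c : Config V) (coin : V → Bool) (v : V) : Prop :=
  ∃ u ∈ c.nbrs G v, coin u = true ∧ ¬ c.Hears G coin u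

open Classical in
/-- The neighbours of `v` in the residual graph that neither beep nor hear a beep: these are the
ones whose beeping probability may grow. -/
noncomputable def quiet (G : SimpleGraph V) (c : Config V) (coin : V → Bool) (v : V) : Finset V :=
  (c.nbrs G v).filter fun u => coin u = false ∧ ¬ c.Hears G coin u

/-- The total beeping probability of the quiet neighbours of `v`. -/
noncomputable def quietMass (G : SimpleGraph V) (c : Config V) (coin : V → Bool) (v : V) : ℝ :=
  ∑ u ∈ c.quiet G coin v, (c u).p

theorem mem_quiet {G : SimpleGraph V} {c : Config V} {coin : V → Bool} {u v : V} :
    u ∈ c.quiet G coin v ↔ u ∈ c.nbrs G v ∧ coin u = false ∧ ¬ c.Hears G coin u := by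
  classical
  simp [quiet]

theorem quietMass_nonneg (G : SimpleGraph V) (c : Config V) (coin : V → Bool) (v : V) :
    0 ≤ c.quietMass G coin v :=
  Finset.sum_nonneg fun u _ => (c u).p_pos.le

theorem quietMass_le_q (G : SimpleGraph V) (c : Config V) (coin : V → Bool) (v : V) :
    c.quietMass G coin v ≤ c.q G v := by
  rw [q_eq_sum]
  exact Finset.sum_le_sum_of_subset_of_nonneg (fun u hu => (mem_quiet.1 hu).1)
    fun u _ _ => (c u).p_pos.le

theorem hears_of_losesNbr {G : SimpleGraph V} {c : Config V} {coin : V → Bool} {v : V}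
    (h : c.LosesNbr G coin v) : c.Hears G coin v := by
  obtain ⟨u, hu, hb, -⟩ := h
  rw [mem_nbrs] at hu
  exact ⟨u, hu.1, hu.2.2, hb⟩

theorem d_next_le (G : SimpleGraph V) (c : Config V) (coin : V → Bool) (v : V) :
    (c.next G coin).d G v ≤ c.d G v := by
  rw [d_eq_card, d_eq_card]
  exact Finset.card_le_card (nbrs_next_subset G c coin v)

theorem d_next_lt {G : SimpleGraph V} {c : Config V} {coin : V → Bool} {v : V}
    (h : c.LosesNbr G coin v) : (c.next G coin).d G v < c.d G v := by
  rw [d_eq_card, d_eq_card]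
  refine Finset.card_lt_card ⟨nbrs_next_subset G c coin v, fun hsub => ?_⟩
  obtain ⟨u, hu, hb, hh⟩ := h
  have h1 := (mem_nbrs.1 (hsub hu)).2.2
  rw [next_of_alone G c coin (mem_nbrs.1 hu).2.2 hh hb] at h1
  cases h1

/-- A neighbour that hears a beep halves its probability; one that is not quiet and hears nothing
leaves the residual graph. -/
theorem q_next_le (G : SimpleGraph V) (c : Config V) (coin : V → Bool) (v : V) :
    (c.next G coin).q G v ≤ c.q G v / 2 + 3 / 2 * c.quietMass G coin v := by
  classical
  have key : ∀ u ∈ (c.next G coin).nbrs G v, (c.next G coin u).p ≤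
      (c u).p / 2 + if coin u = false ∧ ¬ c.Hears G coin u then 3 / 2 * (c u).p else 0 := by
    intro u hu
    have hact' := (mem_nbrs.1 hu).2.2
    have hact := active_of_next_active G c coin hact'
    by_cases hh : c.Hears G coin u
    · simp [hh, (next_of_hears G c coin hact hh).2]
    · cases hb : coin u
      · rw [(next_of_silence G c coin hact hh hb).2]
        have := (c u).doubledP_le
        simp only [hh, not_false_eq_true, and_self, if_true]
        linarith
      · rw [next_of_alone G c coin hact hh hb] at hact'
        cases hact'
  rw [q_eq_sum, q_eq_sum, quietMass, quiet, Finset.sum_filter, Finset.mul_sum, Finset.sum_div,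
    ← Finset.sum_add_distrib]
  refine (Finset.sum_le_sum key).trans
    ((Finset.sum_le_sum_of_subset_of_nonneg (nbrs_next_subset G c coin v) fun u _ _ => ?_).trans
      (Finset.sum_le_sum fun u _ => ?_))
  · have := (c u).p_pos
    positivity
  · split_ifs <;> simp

/-! ### Probabilities of coin events -/

/-- The probability of one outcome of the coins, as a real number. -/
noncomputable def weight (c : Config V) (coin : V → Bool) : ℝ :=
  ∏ v, if coin v then (c v).p else 1 - (c v).p

theorem weight_nonneg (c : Config V) (coin : V → Bool) : 0 ≤ c.weight coin :=
  Finset.prod_nonneg fun u _ => c.ite_coin_nonneg (coin u) u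

theorem coinWeight_eq (c : Config V) (coin : V → Bool) :
    c.coinWeight coin = ENNReal.ofReal (c.weight coin) :=
  (ENNReal.ofReal_prod_of_nonneg fun u _ => c.ite_coin_nonneg (coin u) u).symm

theorem sum_weight_ite [DecidableEq V] (c : Config V) (u : V) (b : Bool) :
    ∑ coin : V → Bool, c.weight coin * (if coin u = b then 1 else 0) =
      if b then (c u).p else 1 - (c u).p := by
  have h : ∀ coin : V → Bool, c.weight coin * (if coin u = b then 1 else 0) =
      ∏ w, (if coin w then (c w).p else 1 - (c w).p) *
        (if w = u then (if coin w = b then 1 else 0) else 1) := by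
    intro coin
    rw [Finset.prod_mul_distrib, Finset.prod_ite_eq' Finset.univ u, weight]
    simp
  simp_rw [h]
  rw [← Fintype.prod_sum (fun w (x : Bool) => (if x then (c w).p else 1 - (c w).p) *
        (if w = u then (if x = b then 1 else 0) else (1 : ℝ))),
    Finset.prod_eq_single u]
  · cases b <;> simp
  · intro w _ hw
    simp [hw]
  · simp

theorem sum_weight [DecidableEq V] (c : Config V) : ∑ coin : V → Bool, c.weight coin = 1 := by
  unfold weight
  rw [← Fintype.prod_sum (fun v (b : Bool) => if b then (c v).p else 1 - (c v).p)]
  exact Finset.prod_eq_one fun v _ => by simp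

open Classical in
/-- The union bound: `v` hears a beep with probability at most `q_v`. -/
theorem sum_weight_hears_le (G : SimpleGraph V) (c : Config V) {v : V}
    (hv : (c v).status = .active) :
    ∑ coin : V → Bool, c.weight coin * (if c.Hears G coin v then 1 else 0) ≤ c.q G v := by
  have h : ∀ coin : V → Bool, c.weight coin * (if c.Hears G coin v then 1 else 0) ≤
      ∑ u ∈ c.nbrs G v, c.weight coin * (if coin u = true then 1 else 0) := by
    intro coin
    have hnn : ∀ u ∈ c.nbrs G v, 0 ≤ c.weight coin * (if coin u = true then (1 : ℝ) else 0) :=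
      fun u _ => mul_nonneg (c.weight_nonneg coin) (by split_ifs <;> norm_num)
    split_ifs with hh
    · obtain ⟨w, hw, hact, hb⟩ := hh
      refine le_trans (le_of_eq ?_) (Finset.single_le_sum hnn (mem_nbrs.2 ⟨hw, hv, hact⟩))
      simp [hb]
    · rw [mul_zero]
      exact Finset.sum_nonneg hnn
  refine (Finset.sum_le_sum fun coin _ => h coin).trans (le_of_eq ?_)
  rw [Finset.sum_comm, q_eq_sum]
  exact Finset.sum_congr rfl fun u _ => by simpa using c.sum_weight_ite u true

/-- Turning the coin of `u` to `true` multiplies the weight by `p_u / (1 - p_u)`, at least `p_u`. -/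
theorem mul_weight_le_weight_update [DecidableEq V] (c : Config V) (coin : V → Bool) {u : V}
    (hu : coin u = false) :
    (c u).p * c.weight coin ≤ c.weight (Function.update coin u true) := by
  have h0 := (c u).p_pos
  unfold weight
  rw [← Finset.mul_prod_erase Finset.univ _ (Finset.mem_univ u),
    ← Finset.mul_prod_erase Finset.univ (fun w => if Function.update coin u true w
      then (c w).p else 1 - (c w).p) (Finset.mem_univ u)]
  have h : ∏ w ∈ Finset.univ.erase u, (if Function.update coin u true w then (c w).p
      else 1 - (c w).p) = ∏ w ∈ Finset.univ.erase u, if coin w then (c w).p else 1 - (c w).p :=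
    Finset.prod_congr rfl fun w hw => by
      rw [Function.update_of_ne (Finset.ne_of_mem_erase hw)]
  rw [h, Function.update_self, hu]
  have hnn : 0 ≤ ∏ w ∈ Finset.univ.erase u, if coin w then (c w).p else 1 - (c w).p :=
    Finset.prod_nonneg fun w _ => c.ite_coin_nonneg (coin w) w
  simp only [Bool.false_eq_true, if_false, if_true]
  exact mul_le_mul_of_nonneg_left (mul_le_of_le_one_left hnn (by linarith)) h0.le

open Classical in
/-- Turning the coin of a quiet neighbour `u` makes `u` the one neighbour of `v` that takes a
colour. As `u` can be read off from the result, this is an injection from the pairs of an outcome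
without loss and a quiet neighbour into the outcomes with a loss. -/
theorem sum_weight_quietMass_le (G : SimpleGraph V) (c : Config V) (v : V) :
    ∑ coin : V → Bool, c.weight coin * (if c.LosesNbr G coin v then 0 else c.quietMass G coin v) ≤
      ∑ coin : V → Bool, c.weight coin * (if c.LosesNbr G coin v then 1 else 0) := by
  set T : Finset ((_ : V → Bool) × V) :=
    (Finset.univ.filter fun coin : V → Bool => ¬ c.LosesNbr G coin v).sigma
      fun coin => c.quiet G coin v with hT
  set φ : ((_ : V → Bool) × V) → (V → Bool) := fun x => Function.update x.1 x.2 true with hφ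
  have memT : ∀ x ∈ T, ¬ c.LosesNbr G x.1 v ∧ x.2 ∈ c.nbrs G v ∧ x.1 x.2 = false ∧
      ¬ c.Hears G x.1 x.2 := by
    intro x hx
    rw [hT, Finset.mem_sigma, Finset.mem_filter, mem_quiet] at hx
    exact ⟨hx.1.2, hx.2⟩
  have hlhs : ∑ coin : V → Bool,
      c.weight coin * (if c.LosesNbr G coin v then 0 else c.quietMass G coin v) =
      ∑ x ∈ T, (c x.2).p * c.weight x.1 := by
    rw [hT, Finset.sum_sigma, Finset.sum_filter]
    refine Finset.sum_congr rfl fun coin _ => ?_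
    by_cases h : c.LosesNbr G coin v
    · simp [h]
    · simp only [h, if_false, not_false_eq_true, if_true, quietMass, Finset.mul_sum]
      exact Finset.sum_congr rfl fun u _ => mul_comm _ _
  have hinj : Set.InjOn φ T := by
    -- A vertex that beeps alone after the turn of `x.2`, and is not `x.2`, beeped alone before it.
    have huniq : ∀ x ∈ T, ∀ w ∈ c.nbrs G v, φ x w = true → ¬ c.Hears G (φ x) w → w = x.2 := by
      intro x hx w hw hb hh
      by_contra hne
      refine (memT x hx).1 ⟨w, hw, ?_, fun h => hh (hears_mono G c (fun y hy => ?_) h)⟩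
      · simpa [hφ, Function.update_of_ne hne] using hb
      · by_cases hyx : y = x.2
        · simp [hφ, hyx]
        · simpa [hφ, Function.update_of_ne hyx] using hy
    intro x hx y hy hxy
    have h2 : x.2 = y.2 := by
      refine huniq y hy x.2 (memT x hx).2.1 ?_ ?_ <;> rw [← hxy]
      · simp [hφ]
      · rw [hφ, hears_update_self]
        exact (memT x hx).2.2.2
    have h1 : x.1 = y.1 := by
      funext w
      by_cases hw : w = x.2
      · rw [hw, (memT x hx).2.2.1, h2, (memT y hy).2.2.1]
      · have := congrFun hxy w
        simpa [hφ, Function.update_of_ne hw, Function.update_of_ne (h2 ▸ hw)] using this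
    exact Sigma.ext h1 (heq_of_eq h2)
  have hrhs : ∑ coin : V → Bool, c.weight coin * (if c.LosesNbr G coin v then 1 else 0) =
      ∑ coin ∈ Finset.univ.filter (fun coin : V → Bool => c.LosesNbr G coin v), c.weight coin := by
    simp [Finset.sum_filter]
  rw [hlhs, hrhs]
  calc ∑ x ∈ T, (c x.2).p * c.weight x.1 ≤ ∑ x ∈ T, c.weight (φ x) :=
        Finset.sum_le_sum fun x hx => c.mul_weight_le_weight_update x.1 (memT x hx).2.2.1
    _ = ∑ coin ∈ T.image φ, c.weight coin := (Finset.sum_image hinj).symm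
    _ ≤ _ := by
        refine Finset.sum_le_sum_of_subset_of_nonneg (fun coin hcoin => ?_)
          fun coin _ _ => c.weight_nonneg coin
        obtain ⟨x, hx, rfl⟩ := Finset.mem_image.1 hcoin
        refine Finset.mem_filter.2 ⟨Finset.mem_univ _, x.2, (memT x hx).2.1, ?_, ?_⟩
        · simp [hφ]
        · rw [hφ, hears_update_self]
          exact (memT x hx).2.2.2

/-! ### The potential -/

/-- The bound of the theorem for `t = 0`. -/
noncomputable def potential (G : SimpleGraph V) (c : Config V) (v : V) : ℝ :=
  colouringAlpha ^ (112 * (c.d G v : ℝ) + c.tZero G v)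

theorem potential_eq (G : SimpleGraph V) (c : Config V) (v : V) :
    c.potential G v = colouringAlpha ^ (112 * (c.d G v : ℝ)) *
      max (5 * c.q G v) 1 ^ (1 / 12 : ℝ) * (c v).p ^ (-(1 / 18) : ℝ) := by
  have h5 : 5 * max (c.q G v) (1 / 5) = max (5 * c.q G v) 1 := by
    rw [mul_max_of_nonneg _ _ (by norm_num)]
    norm_num
  rw [potential, tZero, h5, sub_eq_add_neg, ← neg_mul, ← add_assoc,
    Real.rpow_add colouringAlpha_pos, Real.rpow_add colouringAlpha_pos,
    colouringAlpha_rpow_mul_logb (by positivity), colouringAlpha_rpow_mul_logb (c v).p_pos]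
  norm_num

theorem one_le_potential (G : SimpleGraph V) (c : Config V) (v : V) : 1 ≤ c.potential G v := by
  rw [potential]
  refine Real.one_le_rpow one_lt_colouringAlpha.le ?_
  have h1 : 0 ≤ Real.logb 2 (5 * max (c.q G v) (1 / 5)) :=
    Real.logb_nonneg (by norm_num) (by linarith [le_max_right (c.q G v) (1 / 5)])
  have h2 : Real.logb 2 (c v).p ≤ 0 :=
    Real.logb_nonpos (by norm_num) (c v).p_pos.le (by linarith [(c v).p_le_half])
  rw [tZero]
  have : (0 : ℝ) ≤ c.d G v := by positivity
  linarith

open Classical in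
/-- A bound for the factor that the changes at the neighbours contribute to the potential, relative
to the case that all of them halve their probabilities. -/
noncomputable def nbrFactor (G : SimpleGraph V) (c : Config V) (coin : V → Bool) (v : V) : ℝ :=
  if c.LosesNbr G coin v then 1 / 4 else 1 + 5 / 8 * c.quietMass G coin v

/-- The loss of a neighbour gives the factor `2 ^ (-28 / 9)`, which outweighs the factor
`4 ^ (1 / 12)` that a growth of `q_v` from `m / 5` to `4 m / 5` would give. -/
theorem degree_mul_rpow_next_le (G : SimpleGraph V) (c : Config V) (coin : V → Bool) (v : V) :
    colouringAlpha ^ (112 * ((c.next G coin).d G v : ℝ)) *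
        max (5 * (c.next G coin).q G v) 1 ^ (1 / 12 : ℝ) ≤
      colouringAlpha ^ (112 * (c.d G v : ℝ)) *
        max (5 / 2 * c.q G v) 1 ^ (1 / 12 : ℝ) * c.nbrFactor G coin v := by
  have hq' := q_next_le G c coin v
  have hY0 := quietMass_nonneg G c coin v
  have hYq := quietMass_le_q G c coin v
  have hm1 := le_max_right (5 / 2 * c.q G v) 1
  have hmq := le_max_left (5 / 2 * c.q G v) 1
  set m := max (5 / 2 * c.q G v) 1
  unfold nbrFactor
  split_ifs with hL
  · have hd : 112 * ((c.next G coin).d G v : ℝ) ≤ 112 * (c.d G v : ℝ) + -112 := by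
      have : ((c.next G coin).d G v : ℝ) + 1 ≤ c.d G v := by exact_mod_cast d_next_lt hL
      linarith
    have h1 := Real.rpow_le_rpow_of_exponent_le one_lt_colouringAlpha.le hd
    rw [Real.rpow_add colouringAlpha_pos] at h1
    have h2 : max (5 * (c.next G coin).q G v) 1 ^ (1 / 12 : ℝ) ≤
        m ^ (1 / 12 : ℝ) * 4 ^ (1 / 12 : ℝ) := by
      rw [← Real.mul_rpow (by linarith) (by norm_num)]
      exact Real.rpow_le_rpow (by positivity) (max_le (by linarith) (by linarith)) (by norm_num)
    have h3 : colouringAlpha ^ (-112 : ℝ) * 4 ^ (1 / 12 : ℝ) ≤ 1 / 4 := by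
      rw [colouringAlpha_rpow, show (1 / 4 : ℝ) = 2 ^ (-2 : ℝ) by norm_num,
        show (4 : ℝ) = 2 ^ (2 : ℝ) by norm_num, ← Real.rpow_mul zero_le_two,
        ← Real.rpow_add two_pos]
      exact Real.rpow_le_rpow_of_exponent_le (by norm_num) (by norm_num)
    have hα := colouringAlpha_pos
    calc _ ≤ (colouringAlpha ^ (112 * (c.d G v : ℝ)) * colouringAlpha ^ (-112 : ℝ)) *
          (m ^ (1 / 12 : ℝ) * 4 ^ (1 / 12 : ℝ)) := by gcongr
      _ = colouringAlpha ^ (112 * (c.d G v : ℝ)) * m ^ (1 / 12 : ℝ) *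
          (colouringAlpha ^ (-112 : ℝ) * 4 ^ (1 / 12 : ℝ)) := by ring
      _ ≤ _ := by gcongr
  · have hd : 112 * ((c.next G coin).d G v : ℝ) ≤ 112 * (c.d G v : ℝ) := by
      have : ((c.next G coin).d G v : ℝ) ≤ c.d G v := by exact_mod_cast d_next_le G c coin v
      linarith
    rw [mul_assoc]
    refine mul_le_mul (Real.rpow_le_rpow_of_exponent_le one_lt_colouringAlpha.le hd)
      (le_trans ?_ (rpow_twelfth_le hm1 hY0)) (by positivity)
      (Real.rpow_nonneg colouringAlpha_pos.le _)
    have hmY : c.quietMass G coin v ≤ m * c.quietMass G coin v := le_mul_of_one_le_left hY0 hm1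
    exact Real.rpow_le_rpow (by positivity) (max_le (by linarith) (by linarith)) (by norm_num)

/-! ### The expected potential after one phase -/

open Classical in
/-- The chance of losing a neighbour compensates for the growth of the quiet neighbours, whatever
happens at `v` itself. -/
theorem sum_weight_factors_le (G : SimpleGraph V) (c : Config V) (v : V) :
    ∑ coin : V → Bool, c.weight coin * (c.ownFactor G coin v * c.nbrFactor G coin v) ≤
      ∑ coin : V → Bool, c.weight coin * c.ownFactor G coin v := by
  have key : ∀ coin : V → Bool, c.weight coin * (c.ownFactor G coin v * c.nbrFactor G coin v) ≤
      c.weight coin * c.ownFactor G coin v + colouringAlpha ^ 2 *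
        (5 / 8 * (c.weight coin * (if c.LosesNbr G coin v then 0 else c.quietMass G coin v)) -
          3 / 4 * (c.weight coin * (if c.LosesNbr G coin v then 1 else 0))) := by
    intro coin
    have hw := c.weight_nonneg coin
    unfold nbrFactor
    split_ifs with hL
    · rw [ownFactor, if_pos (hears_of_losesNbr hL)]
      exact le_of_eq (by ring)
    · have h := mul_le_mul_of_nonneg_right (ownFactor_le G c coin v) (quietMass_nonneg G c coin v)
      have := mul_le_mul_of_nonneg_left h hw
      linarith
  refine (Finset.sum_le_sum fun coin _ => key coin).trans ?_
  rw [Finset.sum_add_distrib, ← Finset.mul_sum, Finset.sum_sub_distrib, ← Finset.mul_sum,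
    ← Finset.mul_sum]
  have h1 := sum_weight_quietMass_le G c v
  have h2 : 0 ≤ ∑ coin : V → Bool, c.weight coin * (if c.LosesNbr G coin v then (1 : ℝ) else 0) :=
    Finset.sum_nonneg fun coin _ =>
      mul_nonneg (c.weight_nonneg coin) (by split_ifs <;> norm_num)
  have h3 : 0 ≤ colouringAlpha ^ 2 := sq_nonneg _
  have := mul_nonpos_of_nonneg_of_nonpos h3 (show 5 / 8 * ∑ coin : V → Bool,
      c.weight coin * (if c.LosesNbr G coin v then 0 else c.quietMass G coin v) -
      3 / 4 * ∑ coin : V → Bool, c.weight coin * (if c.LosesNbr G coin v then (1 : ℝ) else 0) ≤ 0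
    by linarith)
  linarith

open Classical in
theorem sum_weight_ownFactor_le (G : SimpleGraph V) (c : Config V) (v : V) :
    ∑ coin : V → Bool, c.weight coin * c.ownFactor G coin v ≤ colouringAlpha ^ 2 := by
  refine (Finset.sum_le_sum fun coin _ =>
    mul_le_mul_of_nonneg_left (ownFactor_le G c coin v) (c.weight_nonneg coin)).trans ?_
  rw [← Finset.sum_mul, sum_weight, one_mul]

open Classical in
/-- For `p_v < 1 / 2` this is the union bound for hearing a beep. For `p_v = 1 / 2` the outcomes in
which `v` stays active without hearing have total probability at most `1 / 2`, which is less than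
the `α⁻² (1 - q_v)` allowed for them. -/
theorem sum_weight_ownFactor_le_of_q_le (G : SimpleGraph V) (c : Config V) {v : V}
    (hv : (c v).status = .active) (hq : c.q G v ≤ 2 / 5) :
    ∑ coin : V → Bool, c.weight coin * c.ownFactor G coin v ≤
      (colouringAlpha ^ 2)⁻¹ +
        (colouringAlpha ^ 2 - (colouringAlpha ^ 2)⁻¹) * c.q G v := by
  have hA := sum_weight_hears_le G c hv
  have h1 : 1 ≤ colouringAlpha ^ 2 := one_le_pow₀ one_lt_colouringAlpha.le
  have h2 : (colouringAlpha ^ 2)⁻¹ ≤ 1 := inv_le_one_of_one_le₀ h1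
  by_cases hp : (c v).p < 1 / 2
  · have key : ∀ coin : V → Bool, c.weight coin * c.ownFactor G coin v =
        (colouringAlpha ^ 2)⁻¹ * c.weight coin + (colouringAlpha ^ 2 - (colouringAlpha ^ 2)⁻¹) *
          (c.weight coin * (if c.Hears G coin v then 1 else 0)) := by
      intro coin
      unfold ownFactor
      split_ifs <;> ring
    simp_rw [key]
    rw [Finset.sum_add_distrib, ← Finset.mul_sum, ← Finset.mul_sum, sum_weight, mul_one]
    have := mul_le_mul_of_nonneg_left hA (show 0 ≤ colouringAlpha ^ 2 - (colouringAlpha ^ 2)⁻¹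
      by linarith)
    linarith
  · have hp' : (c v).p = 1 / 2 := le_antisymm (c v).p_le_half (not_lt.1 hp)
    have key : ∀ coin : V → Bool, c.weight coin * c.ownFactor G coin v ≤
        colouringAlpha ^ 2 * (c.weight coin * (if c.Hears G coin v then 1 else 0)) +
          c.weight coin * (if coin v = false then 1 else 0) := by
      intro coin
      have hw := c.weight_nonneg coin
      unfold ownFactor
      split_ifs <;> linarith
    refine (Finset.sum_le_sum fun coin _ => key coin).trans ?_
    rw [Finset.sum_add_distrib, ← Finset.mul_sum, sum_weight_ite, hp']
    have h3 := mul_le_mul_of_nonneg_left hA (sq_nonneg colouringAlpha)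
    have h4 : (5 / 6 : ℝ) ≤ (colouringAlpha ^ 2)⁻¹ := by
      rw [le_inv_comm₀ (by norm_num) (by linarith)]
      nlinarith [colouringAlpha_lt, colouringAlpha_pos]
    have h5 : 5 / 6 * (1 - c.q G v) ≤ (colouringAlpha ^ 2)⁻¹ * (1 - c.q G v) :=
      mul_le_mul_of_nonneg_right h4 (by linarith)
    simp only [Bool.false_eq_true, if_false]
    linarith

open Classical in
theorem rpow_mul_sum_weight_ownFactor_le (G : SimpleGraph V) (c : Config V) {v : V}
    (hv : (c v).status = .active) :
    max (5 / 2 * c.q G v) 1 ^ (1 / 12 : ℝ) *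
        ∑ coin : V → Bool, c.weight coin * c.ownFactor G coin v ≤
      colouringAlpha⁻¹ * max (5 * c.q G v) 1 ^ (1 / 12 : ℝ) := by
  have hα := colouringAlpha_pos
  rcases le_total (c.q G v) (2 / 5) with hq | hq
  · rw [max_eq_right (by linarith : 5 / 2 * c.q G v ≤ 1), Real.one_rpow, one_mul]
    exact (sum_weight_ownFactor_le_of_q_le G c hv hq).trans (phase_bound (c.q_nonneg G v) hq)
  · rw [max_eq_left (by linarith : 1 ≤ 5 / 2 * c.q G v),
      max_eq_left (by linarith : 1 ≤ 5 * c.q G v),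
      show 5 * c.q G v = 2 * (5 / 2 * c.q G v) by ring,
      Real.mul_rpow (zero_le_two (α := ℝ)) (by linarith), two_rpow_twelfth]
    refine (mul_le_mul_of_nonneg_left (sum_weight_ownFactor_le G c v)
      (Real.rpow_nonneg (by linarith) _)).trans (le_of_eq ?_)
    field_simp

open Classical in
/-- The potential, replaced by `0` at a coloured vertex. -/
noncomputable def activePotential (G : SimpleGraph V) (c : Config V) (v : V) : ℝ :=
  if (c v).status = .active then c.potential G v else 0

theorem activePotential_nonneg (G : SimpleGraph V) (c : Config V) (v : V) :
    0 ≤ c.activePotential G v := by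
  unfold activePotential
  split_ifs
  · linarith [c.one_le_potential G v]
  · rfl

theorem activePotential_next_le (G : SimpleGraph V) (c : Config V) (coin : V → Bool) (v : V) :
    (c.next G coin).activePotential G v ≤
      colouringAlpha ^ (112 * (c.d G v : ℝ)) * max (5 / 2 * c.q G v) 1 ^ (1 / 12 : ℝ) *
        (c v).p ^ (-(1 / 18) : ℝ) * (c.ownFactor G coin v * c.nbrFactor G coin v) := by
  have hα := colouringAlpha_pos
  have hp := (c v).p_pos
  have hp' := (c.next G coin v).p_pos
  have hN : 0 ≤ c.nbrFactor G coin v := by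
    have := quietMass_nonneg G c coin v
    unfold nbrFactor
    split_ifs <;> positivity
  have hO := ownFactor_nonneg G c coin v
  unfold activePotential
  split_ifs with hv
  · rw [potential_eq]
    refine (mul_le_mul (degree_mul_rpow_next_le G c coin v) (rpow_p_next_le G c coin hv)
      (by positivity) (by positivity)).trans (le_of_eq (by ring))
  · positivity

open Classical in
/-- In expectation, one phase lowers the potential by the factor `α`. -/
theorem sum_weight_activePotential_le (G : SimpleGraph V) (c : Config V) (v : V) :
    ∑ coin : V → Bool, c.weight coin * (c.next G coin).activePotential G v ≤
      colouringAlpha⁻¹ * c.activePotential G v := by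
  by_cases hv : (c v).status = .active
  · have hα := colouringAlpha_pos
    have hp := (c v).p_pos
    set K := colouringAlpha ^ (112 * (c.d G v : ℝ)) * (c v).p ^ (-(1 / 18) : ℝ) with hK
    have hK0 : 0 ≤ K := by positivity
    set M := max (5 / 2 * c.q G v) 1 ^ (1 / 12 : ℝ) with hM
    have hM0 : 0 ≤ M := by positivity
    calc _ ≤ ∑ coin : V → Bool, K * (M *
          (c.weight coin * (c.ownFactor G coin v * c.nbrFactor G coin v))) := by
          refine Finset.sum_le_sum fun coin _ => (mul_le_mul_of_nonneg_left
            (activePotential_next_le G c coin v) (c.weight_nonneg coin)).trans (le_of_eq ?_)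
          rw [hK]
          ring
      _ = K * (M * ∑ coin : V → Bool,
          c.weight coin * (c.ownFactor G coin v * c.nbrFactor G coin v)) := by
          rw [Finset.mul_sum, Finset.mul_sum]
      _ ≤ K * (M * ∑ coin : V → Bool, c.weight coin * c.ownFactor G coin v) := by
          exact mul_le_mul_of_nonneg_left (mul_le_mul_of_nonneg_left
            (sum_weight_factors_le G c v) hM0) hK0
      _ ≤ K * (colouringAlpha⁻¹ * max (5 * c.q G v) 1 ^ (1 / 12 : ℝ)) :=
          mul_le_mul_of_nonneg_left (rpow_mul_sum_weight_ownFactor_le G c hv) hK0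
      _ = _ := by
          rw [activePotential, if_pos hv, potential_eq, hK]
          ring
  · have h : ∀ coin : V → Bool, (c.next G coin).activePotential G v = 0 := fun coin => by
      rw [activePotential, next_of_coloured G c coin hv, if_neg hv]
    simp_rw [h]
    simp [activePotential, hv]

/-! ### Iteration over the phases -/

open Classical in
theorem probActive_succ (G : SimpleGraph V) (c : Config V) (t : ℕ) (v : V) :
    c.probActive G (t + 1) v = ∑ coin : V → Bool,
      ENNReal.ofReal (c.weight coin) * (c.next G coin).probActive G t v := by
  rw [probActive, run, step, PMF.bind_map, PMF.toOuterMeasure_bind_apply, tsum_fintype]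
  refine Finset.sum_congr rfl fun coin _ => ?_
  rw [← coinWeight_eq]
  rfl

theorem probActive_le_activePotential (G : SimpleGraph V) (t : ℕ) (c : Config V) (v : V) :
    c.probActive G t v ≤ ENNReal.ofReal ((colouringAlpha⁻¹) ^ t * c.activePotential G v) := by
  classical
  have hα := colouringAlpha_pos
  induction t generalizing c with
  | zero =>
    rw [probActive, run, PMF.toOuterMeasure_pure_apply, activePotential, Set.mem_ofPred_eq]
    split_ifs
    · simpa using c.one_le_potential G v
    · simp
  | succ t ih =>
    rw [probActive_succ]
    calc _ ≤ ∑ coin : V → Bool, ENNReal.ofReal (c.weight coin) *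
          ENNReal.ofReal ((colouringAlpha⁻¹) ^ t * (c.next G coin).activePotential G v) := by
          gcongr
          exact ih _
      _ = ENNReal.ofReal ((colouringAlpha⁻¹) ^ t *
          ∑ coin : V → Bool, c.weight coin * (c.next G coin).activePotential G v) := by
          rw [Finset.mul_sum, ENNReal.ofReal_sum_of_nonneg fun coin _ => mul_nonneg (by positivity)
            (mul_nonneg (c.weight_nonneg coin) (activePotential_nonneg G _ v))]
          refine Finset.sum_congr rfl fun coin _ => ?_
          rw [← ENNReal.ofReal_mul (c.weight_nonneg coin)]
          congr 1
          ring
      _ ≤ _ := by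
          refine ENNReal.ofReal_le_ofReal ?_
          rw [pow_succ, mul_assoc]
          exact mul_le_mul_of_nonneg_left (sum_weight_activePotential_le G c v) (by positivity)

end Config

theorem mainTheorem2 {V : Type*} [Fintype V] (G : SimpleGraph V) (c : Config V) (t : ℕ) (v : V) :
    c.probActive G t v ≤
      ENNReal.ofReal (colouringAlpha ^ (112 * (c.d G v : ℝ) + c.tZero G v - (t : ℝ))) := by
  refine (c.probActive_le_activePotential G t v).trans (ENNReal.ofReal_le_ofReal ?_)
  have hle : c.activePotential G v ≤ c.potential G v := by
    unfold Config.activePotential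
    split_ifs
    · rfl
    · linarith [c.one_le_potential G v]
  have hα := colouringAlpha_pos
  rw [Real.rpow_sub hα, Real.rpow_natCast, inv_pow, div_eq_inv_mul]
  exact mul_le_mul_of_nonneg_left hle (by positivity)
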